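/- Let $d\ge 1$, $-d<\alpha<0$ and $\gamma\ge 2-\frac{\alpha+d}{d}$ (so $\gamma>1$). Let $\Omega$ be either a bounded domain (nonempty connected open set) of $\mathbb{R}^d$ or a flat torus $(\mathbb{R}/L\mathbb{Z})^d$, $L>0$, with Lebesgue measure. Let $W(x)=\pm\frac{|x|^\alpha}{\alpha}$, where on the torus $|x|$ is the length of the shortest representative of $x$, that is, the flat distance from $x$ to $0$, and write $(W*f)(x)=\int_\Omega W(x-y)f(y)\,dy$. Put $h(r)=\frac{r^\gamma}{\gamma-1}$ and $h(r|\bar r)=h(r)-h(\bar r)-h'(\bar r)(r-\bar r)$. For $\kappa>0$ let $$\mathcal E(\rho)=\int_\Omega h(\rho)+\tfrac{\kappa}{2}\rho\,(W*\rho)\,dx,\qquad \mathcal E(\rho|\bar\rho)=\mathcal E(\rho)-\mathcal E(\bar\rho)-\int_\Omega\big(h'(\bar\rho)+\kappa\,W*\bar\rho\big)(\rho-\bar\rho)\,dx .$$ **Proposition.** For all $0<\delta\le\bar M<\infty$ and $M<\infty$ there is a constant $C_*>0$, depending only on $d,\alpha,\gamma,\Omega,\delta,\bar M,M$, such that the following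 holds for either sign in $W$, for every $\rho\in L^\gamma(\Omega)$ with $\rho\ge 0$ a.e. and $\int_\Omega\rho\,dx\le M$, and for every $\bar\rho\in L^\infty(\Omega)$ with $\delta\le\bar\rho\le\bar M$ a.e. 1. The integrals defining $(W*\rho)(x)$ and $(W*\bar\rho)(x)$ converge absolutely for a.e. $x\in\Omega$, the functions $(\rho-\bar\rho)\,(W*(\rho-\bar\rho))$ and $h(\rho|\bar\rho)$ are integrable on $\Omega$, and $$\Big|\int_\Omega(\rho-\bar\rho)\,\big(W*(\rho-\bar\rho)\big)\,dx\Big|\le C_*\int_\Omega h(\rho|\bar\rho)\,dx .$$ 2. For every $\kappa>0$ the three integrals defining $\mathcal E(\rho|\bar\rho)$ (those in $\mathcal E(\rho)$, in $\mathcal E(\bar\rho)$ and the last one) converge absolutely, and $$\mathcal E(\rho|\bar\rho)=\int_\Omega h(\rho|\bar\rho)+\tfrac{\kappa}{2}(\rho-\bar\rho)\,\big(W*(\rho-\bar\rho)\big)\,dx .$$ 3. If $0<\kappa<\frac{2}{C_*}$ and $\lambda=1-\frac{\kappa C_*}{2}>0$, then $$0\le\int_\Omega h(\rho|\bar\rho)\,dx\le\frac1\lambda\,\mathcal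 E(\rho|\bar\rho),$$ and in particular $\mathcal E(\rho|\bar\rho)\ge 0$. -/

import Mathlib

open MeasureTheory

noncomputable section

namespace EulerRiesz

/-- The flat torus `(ℝ / Lℤ)^d`, with the product (Lebesgue) measure of total mass `L ^ d`. -/
abbrev Torus (d : ℕ) (L : ℝ) : Type := Fin d → AddCircle L

/-- The Euclidean length `|x|` on the flat torus, that is the distance from `x` to `0`: the length of
the shortest representative of `x`. On each factor, the norm of `AddCircle L` is the distance
to the nearest multiple of `L`. -/
def torusLength {d : ℕ} {L : ℝ} (x : Torus d L) : ℝ := Real.sqrt (∑ i, ‖x i‖ ^ 2)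

/-- The radial profile `± r ^ α / α` of the interaction kernel, where `s = ± 1` is the sign. -/
def rieszProfile (s α r : ℝ) : ℝ := s * (r ^ α / α)

/-- The interaction kernel `W(x) = ± |x| ^ α / α` on `ℝ^d`. -/
def euclideanKernel (d : ℕ) (s α : ℝ) (x : EuclideanSpace ℝ (Fin d)) : ℝ :=
  rieszProfile s α ‖x‖

/-- The interaction kernel `W(x) = ± |x| ^ α / α` on the flat torus. -/
def torusKernel (d : ℕ) (L s α : ℝ) (x : Torus d L) : ℝ :=
  rieszProfile s α (torusLength x)

/-- The internal energy function `h(r) = r ^ γ / (γ - 1)`. -/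
def internalEnergy (γ r : ℝ) : ℝ := 1 / (γ - 1) * r ^ γ

/-- The relative internal energy `h(r | r') = h(r) - h(r') - h'(r') (r - r')`. -/
def relInternalEnergy (γ r r' : ℝ) : ℝ :=
  internalEnergy γ r - internalEnergy γ r' - deriv (internalEnergy γ) r' * (r - r')

section Functionals

variable {X : Type*} [AddCommGroup X] [MeasurableSpace X]

/-- The potential `(W * f)(x) = ∫ W(x - y) f(y) dμ(y)`; for a domain `Ω ⊆ ℝ^d`, the measure `μ` is
Lebesgue measure restricted to `Ω`. -/
def potential (μ : Measure X) (W : X → ℝ) (f : X → ℝ) (x : X) : ℝ :=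
  ∫ y, W (x - y) * f y ∂μ

/-- The density `h(ρ) + κ (1/2) ρ (W * ρ)` of the potential energy. -/
def energyDensity (μ : Measure X) (W : X → ℝ) (γ κ : ℝ) (ρ : X → ℝ) (x : X) : ℝ :=
  internalEnergy γ (ρ x) + κ * (1 / 2) * (ρ x * potential μ W ρ x)

/-- The potential energy `E(ρ) = ∫ h(ρ) + κ (1/2) ρ (W * ρ)`. -/
def potentialEnergy (μ : Measure X) (W : X → ℝ) (γ κ : ℝ) (ρ : X → ℝ) : ℝ :=
  ∫ x, energyDensity μ W γ κ ρ x ∂μ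

/-- The functional derivative `δE/δρ = h'(ρ) + κ (W * ρ)`. -/
def energyVariation (μ : Measure X) (W : X → ℝ) (γ κ : ℝ) (ρ : X → ℝ) (x : X) : ℝ :=
  deriv (internalEnergy γ) (ρ x) + κ * potential μ W ρ x

/-- The relative potential energy `E(ρ | ρ') = E(ρ) - E(ρ') - ⟨δE/δρ(ρ'), ρ - ρ'⟩`. -/
def relPotentialEnergy (μ : Measure X) (W : X → ℝ) (γ κ : ℝ) (ρ ρ' : X → ℝ) : ℝ :=
  potentialEnergy μ W γ κ ρ - potentialEnergy μ W γ κ ρ' -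
    ∫ x, energyVariation μ W γ κ ρ' x * (ρ x - ρ' x) ∂μ

/-- The density `(ρ - ρ') (W * (ρ - ρ'))` of the relative interaction energy. -/
def relInteraction (μ : Measure X) (W : X → ℝ) (ρ ρ' : X → ℝ) (x : X) : ℝ :=
  (ρ x - ρ' x) * potential μ W (fun y => ρ y - ρ' y) x

/-- The integrals in the potential energies of `ρ` and `ρ'` and in the pairing of `δE/δρ(ρ')`
with `ρ - ρ'` converge absolutely. -/
structure FiniteEnergies (μ : Measure X) (W : X → ℝ) (γ κ : ℝ) (ρ ρ' : X → ℝ) : Prop where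
  left : Integrable (energyDensity μ W γ κ ρ) μ
  right : Integrable (energyDensity μ W γ κ ρ') μ
  pairing : Integrable (fun x => energyVariation μ W γ κ ρ' x * (ρ x - ρ' x)) μ

end Functionals

/-- `0 ≤ ρ ∈ L^γ` has mass at most `M`, and `ρ' ∈ L^∞` satisfies `δ ≤ ρ' ≤ M'`. -/
structure Admissible {X : Type*} [MeasurableSpace X] (μ : Measure X) (γ δ M' M : ℝ)
    (ρ ρ' : X → ℝ) : Prop where
  memLp : MemLp ρ (ENNReal.ofReal γ) μ
  nonneg : ∀ᵐ x ∂μ, 0 ≤ ρ x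
  mass_le : ∫ x, ρ x ∂μ ≤ M
  memLp_top : MemLp ρ' ⊤ μ
  lower : ∀ᵐ x ∂μ, δ ≤ ρ' x
  upper : ∀ᵐ x ∂μ, ρ' x ≤ M'

/-- The relative energy estimate with constant `C`. The first two fields say that `W * ρ` and
`W * ρ'` are given by absolutely convergent integrals almost everywhere. -/
structure RelEnergyEstimate {X : Type*} [AddCommGroup X] [MeasurableSpace X] (μ : Measure X)
    (W : X → ℝ) (γ C : ℝ) (ρ ρ' : X → ℝ) : Prop where
  potential_left : ∀ᵐ x ∂μ, Integrable (fun y => W (x - y) * ρ y) μ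
  potential_right : ∀ᵐ x ∂μ, Integrable (fun y => W (x - y) * ρ' y) μ
  integrable_interaction : Integrable (relInteraction μ W ρ ρ') μ
  integrable_internal : Integrable (fun x => relInternalEnergy γ (ρ x) (ρ' x)) μ
  interaction_le :
    |∫ x, relInteraction μ W ρ ρ' x ∂μ| ≤ C * ∫ x, relInternalEnergy γ (ρ x) (ρ' x) ∂μ

end EulerRiesz

end

/-! Two estimates meet at the function `growth`, which is `t ^ 2` for `t ≤ 1` and `t ^ γ` beyond.
Coercivity (`exists_growth_le_relInternalEnergy`): since `ρ'` stays in a compact part of `(0, ∞)`,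
`h(ρ|ρ')` is at least a constant times `growth γ |ρ - ρ'|`; uniform convexity gives the quadratic
part, and the superlinear growth of `h` gives the power part. Interaction
(`lintegral_interaction_le`): with `β = -α / d < 1`, the kernel `|x| ^ α` is of weak type `1 / β`.
In the double integral for `f = |ρ - ρ'|`, symmetry allows restriction to pairs with `f y ≤ f x`.
Then `y ↦ f y` is bounded by `f x` and has controlled mass, so integrating over `y` yields at most a
constant times `f x ^ (1 + β)`, or `f x ^ 2` if `f x ≤ 1`. The hypothesis on `γ` says exactly `1 + β
≤ γ`, so both cases are bounded by `growth γ (f x)`. The energy identity is the expansion of a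
quadratic form, symmetric by Fubini and evenness of `W`; the stability bound then follows by
absorbing the interaction. -/

namespace EulerRiesz

/-! ### Coercivity of the relative internal energy -/

theorem hasDerivAt_internalEnergy {γ : ℝ} (hγ : 1 < γ) (r : ℝ) :
    HasDerivAt (internalEnergy γ) (γ / (γ - 1) * r ^ (γ - 1)) r := by
  have h := (Real.hasDerivAt_rpow_const (x := r) (p := γ) (Or.inr hγ.le)).const_mul (1 / (γ - 1))
  refine h.congr_deriv ?_
  ring

theorem relInternalEnergy_eq {γ : ℝ} (hγ : 1 < γ) (r r' : ℝ) :
    relInternalEnergy γ r r' =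
      1 / (γ - 1) * r ^ γ - 1 / (γ - 1) * r' ^ γ - γ / (γ - 1) * r' ^ (γ - 1) * (r - r') := by
  rw [relInternalEnergy, (hasDerivAt_internalEnergy hγ r').deriv, internalEnergy, internalEnergy]

/-- The relative energy is convex in its first argument and vanishes at `r = r'`. Passing to the
midpoint keeps that argument above `r' / 2`, away from `0`, where `h''` degenerates or blows up
unless `γ = 2`. -/
theorem relInternalEnergy_midpoint_le {γ r r' : ℝ} (hγ : 1 < γ) (hr : 0 ≤ r) (hr' : 0 ≤ r') :
    2 * relInternalEnergy γ ((r + r') / 2) r' ≤ relInternalEnergy γ r r' := by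
  have h := (convexOn_rpow hγ.le).2 hr hr' (by norm_num : (0 : ℝ) ≤ 1 / 2)
    (by norm_num : (0 : ℝ) ≤ 1 / 2) (by norm_num)
  simp only [smul_eq_mul] at h
  have h1 : 1 / 2 * r + 1 / 2 * r' = (r + r') / 2 := by ring
  rw [h1] at h
  rw [relInternalEnergy_eq hγ, relInternalEnergy_eq hγ]
  have h2 : 0 < 1 / (γ - 1) := one_div_pos.2 (by linarith)
  nlinarith [mul_le_mul_of_nonneg_left h h2.le]

/-- On a compact subinterval of `(0, ∞)` the relative internal energy is uniformly convex. -/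
theorem exists_sq_le_relInternalEnergy_Icc {γ a b : ℝ} (hγ : 1 < γ) (ha : 0 < a) (hab : a ≤ b) :
    ∃ c : ℝ, 0 < c ∧ ∀ r ∈ Set.Icc a b, ∀ r' ∈ Set.Icc a b,
      c * (r - r') ^ 2 ≤ relInternalEnergy γ r r' := by
  have hb : 0 < b := ha.trans_le hab
  -- The minimum of `h''(s) = γ * s ^ (γ - 2)` on `[a, b]`; by monotonicity it sits at an endpoint.
  set m : ℝ := γ * min (a ^ (γ - 2)) (b ^ (γ - 2)) with hm
  have hmpos : 0 < m :=
    mul_pos (by linarith) (lt_min (Real.rpow_pos_of_pos ha _) (Real.rpow_pos_of_pos hb _))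
  have hlow : ∀ s ∈ Set.Icc a b, m ≤ γ * s ^ (γ - 2) := by
    intro s hs
    refine mul_le_mul_of_nonneg_left ?_ (by linarith)
    have hs0 : 0 < s := ha.trans_le hs.1
    rcases le_total 2 γ with h | h
    · exact (min_le_left _ _).trans (Real.rpow_le_rpow ha.le hs.1 (by linarith))
    · exact (min_le_right _ _).trans (Real.rpow_le_rpow_of_nonpos hs0 hs.2 (by linarith))
  -- What remains after removing this parabola is convex, and its tangent inequality at `r'` is the
  -- claim with `c = m / 2`.
  set f : ℝ → ℝ := fun s => internalEnergy γ s - m / 2 * s ^ 2 with hf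
  have hf1 : ∀ s : ℝ, HasDerivAt f (γ / (γ - 1) * s ^ (γ - 1) - m * s) s := by
    intro s
    have h := (hasDerivAt_internalEnergy hγ s).sub (((hasDerivAt_id s).pow 2).const_mul (m / 2))
    refine h.congr_deriv ?_
    simp
    ring
  have hf2 : ∀ s ∈ Set.Icc a b, HasDerivAt (fun s : ℝ => γ / (γ - 1) * s ^ (γ - 1) - m * s)
      (γ * s ^ (γ - 2) - m) s := by
    intro s hs
    have hs0 : s ≠ 0 := (ha.trans_le hs.1).ne'
    have h := ((Real.hasDerivAt_rpow_const (x := s) (p := γ - 1) (Or.inl hs0)).const_mul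
      (γ / (γ - 1))).sub ((hasDerivAt_id s).const_mul m)
    refine h.congr_deriv ?_
    have : γ - 1 ≠ 0 := by linarith
    rw [show γ - 1 - 1 = γ - 2 by ring]
    field_simp
  have hconv : ConvexOn ℝ (Set.Icc a b) f := by
    refine convexOn_of_hasDerivWithinAt2_nonneg (convex_Icc a b)
      (fun s _ => (hf1 s).continuousAt.continuousWithinAt)
      (fun s _ => (hf1 s).hasDerivWithinAt)
      (fun s hs => (hf2 s (interior_subset hs)).hasDerivWithinAt) ?_
    intro s hs
    linarith [hlow s (interior_subset hs)]
  refine ⟨m / 2, by positivity, fun r hr r' hr' => ?_⟩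
  have key : f r' + (γ / (γ - 1) * r' ^ (γ - 1) - m * r') * (r - r') ≤ f r := by
    rcases lt_trichotomy r r' with h | h | h
    · have := hconv.slope_le_of_hasDerivAt hr hr' h (hf1 r')
      rw [slope_def_field, div_le_iff₀ (by linarith)] at this
      linarith
    · simp [h]
    · have := hconv.le_slope_of_hasDerivAt hr' hr h (hf1 r')
      rw [slope_def_field, le_div_iff₀ (by linarith)] at this
      linarith
  rw [relInternalEnergy, (hasDerivAt_internalEnergy hγ r').deriv]
  simp only [hf] at key
  nlinarith

/-- The function `t ^ 2` for `t ≤ 1` and `t ^ γ` for `t > 1`, which is comparable to the relative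
internal energy at distance `t`. -/
noncomputable def growth (γ t : ℝ) : ℝ := if t ≤ 1 then t ^ 2 else t ^ γ

theorem growth_nonneg (γ : ℝ) {t : ℝ} (ht : 0 ≤ t) : 0 ≤ growth γ t := by
  unfold growth
  split_ifs <;> positivity

theorem growth_le {γ t : ℝ} (ht : 0 ≤ t) : growth γ t ≤ 1 + t ^ γ := by
  unfold growth
  have := Real.rpow_nonneg ht γ
  split_ifs with h
  · nlinarith
  · linarith

/-- Coercivity of the relative internal energy, uniformly for `r'` in `[δ, b]`. -/
theorem exists_growth_le_relInternalEnergy {γ δ b : ℝ} (hγ : 1 < γ) (hδ : 0 < δ) :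
    ∃ c : ℝ, 0 < c ∧ ∀ r r' : ℝ, 0 ≤ r → δ ≤ r' → r' ≤ b →
      c * growth γ |r - r'| ≤ relInternalEnergy γ r r' := by
  by_cases hδb : δ ≤ b
  swap
  · exact ⟨1, one_pos, fun r r' _ h1 h2 => absurd (h1.trans h2) hδb⟩
  have hb : 0 < b := hδ.trans_le hδb
  have hγ1 : 0 < γ - 1 := by linarith
  -- With `K ^ (γ - 1) = 2 * γ`, the tangent term `h'(r') * r` is at most `h(r) / 2` once `r ≥ K *
  -- r'`.
  set K : ℝ := (2 * γ) ^ (1 / (γ - 1)) with hK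
  have hK1 : 1 ≤ K := Real.one_le_rpow (by linarith) (by positivity)
  have hKpow : K ^ (γ - 1) = 2 * γ := by
    rw [hK, ← Real.rpow_mul (by linarith), one_div_mul_cancel hγ1.ne', Real.rpow_one]
  set R : ℝ := K * b + 1 with hR
  have hbR : b ≤ R := by nlinarith
  have hR1 : 1 ≤ R := by rw [hR]; nlinarith
  have hR0 : 0 < R := hb.trans_le hbR
  obtain ⟨c₀, hc₀, hsq⟩ := exists_sq_le_relInternalEnergy_Icc hγ (half_pos hδ)
    (by linarith : δ / 2 ≤ R)
  have hS : 0 < R ^ γ + 1 := by positivity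
  -- For `r ≤ R` and `|r - r'| > 1`, `growth` is at most `R ^ γ` while the quadratic bound is at
  -- least `c₀ / 2`.
  set c₁ : ℝ := c₀ / 2 / (R ^ γ + 1) with hc₁
  set c₂ : ℝ := 1 / (2 * (γ - 1)) with hc₂
  have hc₁pos : 0 < c₁ := by positivity
  have hc₂pos : 0 < c₂ := by positivity
  have hc₁le : c₁ ≤ c₀ / 2 := by
    refine div_le_self (by positivity) ?_
    linarith [Real.rpow_nonneg hR0.le γ]
  refine ⟨min c₁ c₂, lt_min hc₁pos hc₂pos, fun r r' hr h1 h2 => ?_⟩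
  have hr' : 0 < r' := hδ.trans_le h1
  have hg := growth_nonneg γ (abs_nonneg (r - r'))
  have hquad : r ≤ R → c₀ / 2 * (r - r') ^ 2 ≤ relInternalEnergy γ r r' := by
    intro hrR
    have h := hsq ((r + r') / 2) ⟨by linarith, by linarith⟩ r' ⟨by linarith, by linarith⟩
    have h' := relInternalEnergy_midpoint_le hγ hr hr'.le
    nlinarith
  have hlarge : R ≤ r → c₂ * r ^ γ ≤ relInternalEnergy γ r r' := by
    intro hrR
    have hr0 : 0 < r := hR0.trans_le hrR
    rw [relInternalEnergy_eq hγ]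
    have e1 : r ^ γ = r * r ^ (γ - 1) := by
      rw [← Real.rpow_one_add' hr0.le (by linarith)]; ring_nf
    have e2 : r' ^ γ = r' * r' ^ (γ - 1) := by
      rw [← Real.rpow_one_add' hr'.le (by linarith)]; ring_nf
    have e3 : 2 * γ * r' ^ (γ - 1) ≤ r ^ (γ - 1) := by
      rw [← hKpow, ← Real.mul_rpow (by linarith) hr'.le]
      exact Real.rpow_le_rpow (by positivity) (by nlinarith) hγ1.le
    have e4 : 0 ≤ r' * r' ^ (γ - 1) := by positivity
    rw [e1, e2, hc₂]
    -- Half of `h(r)` is kept as the lower bound; the other half absorbs the tangent term.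
    have e5 : 1 / (γ - 1) * (r * r ^ (γ - 1)) - 1 / (γ - 1) * (r' * r' ^ (γ - 1)) -
        γ / (γ - 1) * r' ^ (γ - 1) * (r - r') - 1 / (2 * (γ - 1)) * (r * r ^ (γ - 1)) =
        1 / (2 * (γ - 1)) * r * (r ^ (γ - 1) - 2 * γ * r' ^ (γ - 1)) + r' * r' ^ (γ - 1) := by
      field_simp
      ring
    have e6 : 0 ≤ 1 / (2 * (γ - 1)) * r * (r ^ (γ - 1) - 2 * γ * r' ^ (γ - 1)) :=
      mul_nonneg (by positivity) (by linarith)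
    linarith
  rcases le_total r R with hrR | hrR
  · refine le_trans ?_ (hquad hrR)
    refine (mul_le_mul_of_nonneg_right (min_le_left _ _) hg).trans ?_
    unfold growth
    split_ifs with ht
    · rw [sq_abs]
      exact mul_le_mul_of_nonneg_right hc₁le (sq_nonneg _)
    · push Not at ht
      have hd : |r - r'| ≤ R := by
        rw [abs_le]; constructor <;> linarith
      have h3 : |r - r'| ^ γ ≤ R ^ γ := Real.rpow_le_rpow (abs_nonneg _) hd (by linarith)
      have h4 : 1 ≤ (r - r') ^ 2 := by
        rw [← sq_abs]; nlinarith
      calc c₁ * |r - r'| ^ γ ≤ c₁ * (R ^ γ + 1) := by gcongr; linarith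
        _ = c₀ / 2 := by rw [hc₁]; field_simp
        _ ≤ c₀ / 2 * (r - r') ^ 2 := le_mul_of_one_le_right (by positivity) h4
  · have hle : |r - r'| ≤ r := by
      rw [abs_of_nonneg (by linarith)]; linarith
    refine le_trans ?_ (hlarge hrR)
    refine mul_le_mul (min_le_right _ _) ?_ (growth_nonneg γ (abs_nonneg _)) hc₂pos.le
    unfold growth
    split_ifs with ht
    · exact (pow_le_one₀ (abs_nonneg _) ht).trans
        (Real.one_le_rpow (hR1.trans hrR) (by linarith))
    · exact Real.rpow_le_rpow (abs_nonneg _) hle (by linarith)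

end EulerRiesz

namespace EulerRiesz

/-! ### Weak-type kernels and the interaction inequality -/

section WeakType

variable {X : Type*} [MeasurableSpace X] {μ : Measure X} {A β : ℝ}

theorem lintegral_Ioi_ofReal_rpow_neg {A p s : ℝ} (hA : 0 ≤ A) (hp : 1 < p) (hs : 0 < s) :
    ∫⁻ t in Set.Ioi s, ENNReal.ofReal (A * t ^ (-p)) =
      ENNReal.ofReal (A * s ^ (1 - p) / (p - 1)) := by
  rw [← ofReal_integral_eq_lintegral_ofReal
    ((integrableOn_Ioi_rpow_of_lt (by linarith) hs).const_mul A)]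
  · rw [integral_const_mul, integral_Ioi_rpow_of_lt (by linarith) hs]
    congr 1
    rw [show -p + 1 = 1 - p by ring, ← neg_sub p 1, neg_div_neg_eq, mul_div_assoc]
  · filter_upwards [ae_restrict_mem measurableSet_Ioi] with t ht
    exact mul_nonneg hA (Real.rpow_nonneg (hs.trans ht).le _)

/-- Integrals of a function of weak type `1 / β` over its superlevel sets. -/
theorem setLIntegral_superlevel_le {u : X → ℝ} (hu : Measurable u) (hu0 : 0 ≤ u) (hA : 0 ≤ A)
    (hβ : 0 < β) (hβ1 : β < 1)
    (hw : ∀ s : ℝ, 0 < s → μ {y | s < u y} ≤ ENNReal.ofReal (A * s ^ (-(1 / β)))) {s : ℝ}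
    (hs : 0 < s) :
    ∫⁻ y in {y | s < u y}, ENNReal.ofReal (u y) ∂μ ≤
      ENNReal.ofReal (A * (1 + 1 / (1 / β - 1)) * s ^ (1 - 1 / β)) := by
  have hp : 1 < 1 / β := one_lt_one_div hβ hβ1
  set p : ℝ := 1 / β
  have hp1 : 0 < p - 1 := by linarith
  -- Layer cake, split at height `s`: below `s` the level set inside `{s < u}` is all of `{s < u}`,
  -- above `s` the weak-type tail is integrable because `1 / β > 1`.
  rw [lintegral_eq_lintegral_meas_lt _ (Filter.Eventually.of_forall hu0) hu.aemeasurable,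
    ← Set.Ioc_union_Ioi_eq_Ioi hs.le]
  refine (lintegral_union_le _ _ _).trans ?_
  have h1 : ∫⁻ t in Set.Ioc 0 s, (μ.restrict {y | s < u y}) {y | t < u y} ≤
      ENNReal.ofReal (A * s ^ (1 - p)) := by
    calc ∫⁻ t in Set.Ioc 0 s, (μ.restrict {y | s < u y}) {y | t < u y}
        ≤ ∫⁻ _ in Set.Ioc 0 s, ENNReal.ofReal (A * s ^ (-p)) := by
          refine lintegral_mono fun t => ?_
          refine (measure_mono (Set.subset_univ _)).trans ?_
          rw [Measure.restrict_apply_univ]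
          exact hw s hs
      _ = ENNReal.ofReal (A * s ^ (1 - p)) := by
          rw [setLIntegral_const, Real.volume_Ioc, sub_zero, ← ENNReal.ofReal_mul (by positivity),
            mul_assoc, ← Real.rpow_add_one hs.ne', neg_add_eq_sub]
  have h2 : ∫⁻ t in Set.Ioi s, (μ.restrict {y | s < u y}) {y | t < u y} ≤
      ENNReal.ofReal (A * s ^ (1 - p) / (p - 1)) := by
    rw [← lintegral_Ioi_ofReal_rpow_neg hA hp hs]
    refine setLIntegral_mono (by fun_prop) fun t ht => ?_
    exact (Measure.restrict_apply_le _ _).trans (hw t (hs.trans ht))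
  refine (add_le_add h1 h2).trans ?_
  rw [← ENNReal.ofReal_add (by positivity) (by positivity)]
  refine ENNReal.ofReal_le_ofReal (le_of_eq ?_)
  ring

/-- The pairing of a function of weak type `1 / β` with a bounded function of finite mass. -/
theorem lintegral_mul_le_of_weakType {u : X → ℝ} (hu : Measurable u) (hu0 : 0 ≤ u) (hA : 0 ≤ A)
    (hβ : 0 < β) (hβ1 : β < 1)
    (hw : ∀ s : ℝ, 0 < s → μ {y | s < u y} ≤ ENNReal.ofReal (A * s ^ (-(1 / β))))
    {g : X → ENNReal} {t m : ℝ} (ht : 0 < t) (hm : 0 ≤ m)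
    (hgt : ∀ y, g y ≤ ENNReal.ofReal t) (hgm : ∫⁻ y, g y ∂μ ≤ ENNReal.ofReal m) :
    ∫⁻ y, ENNReal.ofReal (u y) * g y ∂μ ≤
      ENNReal.ofReal ((A * (1 + 1 / (1 / β - 1)) + m) * t ^ β) := by
  have hp : 1 < 1 / β := one_lt_one_div hβ hβ1
  have hp1 : 0 < 1 / β - 1 := by linarith
  -- Cutting `u` at height `t ^ β` balances the two pieces: above it `g ≤ t` gives `(t ^ β) ^ (1 - 1
  -- / β) * t = t ^ β`, below it the mass gives `m * t ^ β`.
  have hs : 0 < t ^ β := Real.rpow_pos_of_pos ht _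
  have hB : MeasurableSet {y | t ^ β < u y} := measurableSet_lt measurable_const hu
  rw [← lintegral_add_compl _ hB]
  have h1 : ∫⁻ y in {y | t ^ β < u y}, ENNReal.ofReal (u y) * g y ∂μ ≤
      ENNReal.ofReal (A * (1 + 1 / (1 / β - 1)) * t ^ β) := by
    calc ∫⁻ y in {y | t ^ β < u y}, ENNReal.ofReal (u y) * g y ∂μ
        ≤ ∫⁻ y in {y | t ^ β < u y}, ENNReal.ofReal (u y) * ENNReal.ofReal t ∂μ :=
          lintegral_mono fun y => mul_le_mul_right (hgt y) _
      _ = (∫⁻ y in {y | t ^ β < u y}, ENNReal.ofReal (u y) ∂μ) * ENNReal.ofReal t :=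
          lintegral_mul_const _ (by fun_prop)
      _ ≤ ENNReal.ofReal (A * (1 + 1 / (1 / β - 1)) * (t ^ β) ^ (1 - 1 / β)) *
            ENNReal.ofReal t :=
          mul_le_mul_left (setLIntegral_superlevel_le hu hu0 hA hβ hβ1 hw hs) _
      _ = ENNReal.ofReal (A * (1 + 1 / (1 / β - 1)) * t ^ β) := by
          rw [← ENNReal.ofReal_mul (by positivity), mul_assoc, ← Real.rpow_mul ht.le,
            ← Real.rpow_add_one ht.ne']
          congr 3
          field_simp
          ring
  have h2 : ∫⁻ y in {y | t ^ β < u y}ᶜ, ENNReal.ofReal (u y) * g y ∂μ ≤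
      ENNReal.ofReal (m * t ^ β) := by
    calc ∫⁻ y in {y | t ^ β < u y}ᶜ, ENNReal.ofReal (u y) * g y ∂μ
        ≤ ∫⁻ y in {y | t ^ β < u y}ᶜ, ENNReal.ofReal (t ^ β) * g y ∂μ := by
          refine setLIntegral_mono' hB.compl fun y hy => mul_le_mul_left ?_ _
          exact ENNReal.ofReal_le_ofReal (not_lt.1 hy)
      _ ≤ ∫⁻ y, ENNReal.ofReal (t ^ β) * g y ∂μ := setLIntegral_le_lintegral _ _
      _ = ENNReal.ofReal (t ^ β) * ∫⁻ y, g y ∂μ := lintegral_const_mul' _ _ ENNReal.ofReal_ne_top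
      _ ≤ ENNReal.ofReal (t ^ β) * ENNReal.ofReal m := mul_le_mul_right hgm _
      _ = ENNReal.ofReal (m * t ^ β) := by rw [← ENNReal.ofReal_mul hs.le, mul_comm]
  refine (add_le_add h1 h2).trans ?_
  rw [← ENNReal.ofReal_add (by positivity) (by positivity), add_mul]

/-- A Hardy–Littlewood–Sobolev type inequality on the diagonal: the interaction energy with a
symmetric kernel of weak type `1 / β` is controlled by the integral of `growth γ ∘ f`. -/
theorem lintegral_interaction_le [IsFiniteMeasure μ] {γ : ℝ} {K : X → X → ℝ}
    (hK : Measurable (Function.uncurry K)) (hK0 : ∀ x y, 0 ≤ K x y)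
    (hKs : ∀ x y, K x y = K y x) (hA : 0 ≤ A)
    (hβ : 0 < β) (hβ1 : β < 1) (hβγ : 1 + β ≤ γ)
    (hw : ∀ x, ∀ s : ℝ, 0 < s → μ {y | s < K x y} ≤ ENNReal.ofReal (A * s ^ (-(1 / β))))
    {f : X → ℝ} (hf : AEMeasurable f μ) {m : ℝ} (hm : 0 ≤ m)
    (hfm : ∫⁻ y, ENNReal.ofReal (f y) ∂μ ≤ ENNReal.ofReal m) :
    ∫⁻ x, ∫⁻ y, ENNReal.ofReal (K x y) * (ENNReal.ofReal (f x) * ENNReal.ofReal (f y)) ∂μ ∂μ ≤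
      ENNReal.ofReal (2 * (A * (1 + 1 / (1 / β - 1)) + m + μ.real Set.univ)) *
        ∫⁻ x, ENNReal.ofReal (growth γ |f x|) ∂μ := by
  -- A measurable representative makes the region `f y ≤ f x` measurable in the product.
  wlog hfmeas : Measurable f generalizing f
  · have hae := hf.ae_eq_mk
    have h := this (f := hf.mk f) hf.measurable_mk.aemeasurable ?_ hf.measurable_mk
    · convert h using 1
      · refine lintegral_congr_ae ?_
        filter_upwards [hae] with x hx
        refine lintegral_congr_ae ?_
        filter_upwards [hae] with y hy
        rw [hx, hy]
      · congr 1
        refine lintegral_congr_ae ?_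
        filter_upwards [hae] with x hx
        rw [hx]
    · have hfeq : (fun y => ENNReal.ofReal (f y)) =ᵐ[μ] fun y => ENNReal.ofReal (hf.mk f y) :=
        hae.mono fun x hx => congrArg ENNReal.ofReal hx
      rwa [← lintegral_congr_ae hfeq]
  have hp : 1 < 1 / β := one_lt_one_div hβ hβ1
  have hp1 : 0 < 1 / β - 1 := by linarith
  set C : ℝ := A * (1 + 1 / (1 / β - 1)) + m + μ.real Set.univ with hC
  have hμ0 : 0 ≤ μ.real Set.univ := measureReal_nonneg
  have hA' : 0 ≤ A * (1 + 1 / (1 / β - 1)) := by positivity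
  have hC0 : 0 ≤ C := by positivity
  set F : X → X → ENNReal := fun x y =>
    ENNReal.ofReal (K x y) * (ENNReal.ofReal (f x) * ENNReal.ofReal (f y)) with hF
  have hFm : Measurable (Function.uncurry F) := by
    have h1 : Measurable fun z : X × X => ENNReal.ofReal (K z.1 z.2) := hK.ennreal_ofReal
    exact h1.mul ((hfmeas.comp measurable_fst).ennreal_ofReal.mul
      (hfmeas.comp measurable_snd).ennreal_ofReal)
  -- `G` keeps the pairs in which `x` carries the larger value; symmetry of `F` recovers the rest at
  -- the cost of a factor `2`.
  set G : X → X → ENNReal := fun x y => if f y ≤ f x then F x y else 0 with hG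
  have hGm : Measurable (Function.uncurry G) :=
    Measurable.ite (measurableSet_le (hfmeas.comp measurable_snd) (hfmeas.comp measurable_fst))
      hFm measurable_const
  have hFG : ∀ x y, F x y ≤ G x y + G y x := by
    intro x y
    have hs : F y x = F x y := by simp only [hF]; rw [hKs, mul_comm (ENNReal.ofReal (f y))]
    rcases le_total (f y) (f x) with h | h
    · exact le_add_right (by simp [hG, h])
    · exact le_add_left (by simp [hG, h, hs])
  have hGle : ∀ x, ∫⁻ y, G x y ∂μ ≤ ENNReal.ofReal C * ENNReal.ofReal (growth γ |f x|) := by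
    intro x
    rcases le_or_gt (f x) 0 with h0 | h0
    · have : ∀ y, G x y = 0 := by
        intro y
        simp [hG, hF, ENNReal.ofReal_of_nonpos h0]
      simp [this]
    have hKx : Measurable (K x) := hK.comp measurable_prodMk_left
    set g : X → ENNReal := fun y => if f y ≤ f x then ENNReal.ofReal (f y) else 0 with hg
    have hgle : ∀ y, g y ≤ ENNReal.ofReal (f x) := by
      intro y
      simp only [hg]
      split_ifs with h
      · exact ENNReal.ofReal_le_ofReal h
      · exact zero_le
    have hgm : ∫⁻ y, g y ∂μ ≤ ENNReal.ofReal m := by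
      refine (lintegral_mono fun y => ?_).trans hfm
      simp only [hg]
      split_ifs
      · exact le_rfl
      · exact zero_le
    have hGg : ∫⁻ y, G x y ∂μ =
        ENNReal.ofReal (f x) * ∫⁻ y, ENNReal.ofReal (K x y) * g y ∂μ := by
      rw [← lintegral_const_mul' _ _ ENNReal.ofReal_ne_top]
      refine lintegral_congr fun y => ?_
      simp only [hG, hg, hF]
      split_ifs
      · ring
      · simp
    rw [hGg, abs_of_pos h0, growth, ← ENNReal.ofReal_mul hC0]
    split_ifs with h1
    -- For `f x ≤ 1` the mass bound would give only `f x ^ (1 + β)`, too large against `f x ^ 2`.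
    -- Instead both factors are bounded by `f x`, and the kernel is paired with `1`, whose mass is
    -- the total measure.
    · have hKint : ∫⁻ y, ENNReal.ofReal (K x y) * 1 ∂μ ≤
          ENNReal.ofReal ((A * (1 + 1 / (1 / β - 1)) + μ.real Set.univ) * 1 ^ β) :=
        lintegral_mul_le_of_weakType hKx (hK0 x) hA hβ hβ1 (hw x) one_pos hμ0 (by simp)
          (by simp)
      calc ENNReal.ofReal (f x) * ∫⁻ y, ENNReal.ofReal (K x y) * g y ∂μ
          ≤ ENNReal.ofReal (f x) *
              ∫⁻ y, ENNReal.ofReal (f x) * (ENNReal.ofReal (K x y) * 1) ∂μ := by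
            refine mul_le_mul_right (lintegral_mono fun y => ?_) _
            rw [mul_one, mul_comm (ENNReal.ofReal (f x))]
            exact mul_le_mul_right (hgle y) _
        _ = ENNReal.ofReal (f x) * (ENNReal.ofReal (f x) *
              ∫⁻ y, ENNReal.ofReal (K x y) * 1 ∂μ) := by
            rw [lintegral_const_mul' _ _ ENNReal.ofReal_ne_top]
        _ ≤ ENNReal.ofReal (f x) * (ENNReal.ofReal (f x) *
              ENNReal.ofReal ((A * (1 + 1 / (1 / β - 1)) + μ.real Set.univ) * 1 ^ β)) := by
            gcongr
        _ ≤ ENNReal.ofReal (C * f x ^ 2) := by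
            rw [← ENNReal.ofReal_mul h0.le, ← ENNReal.ofReal_mul h0.le]
            refine ENNReal.ofReal_le_ofReal ?_
            rw [Real.one_rpow, mul_one]
            have : 0 ≤ m * f x ^ 2 := by positivity
            rw [hC]
            linarith
    · push Not at h1
      refine (mul_le_mul_right (lintegral_mul_le_of_weakType hKx (hK0 x) hA hβ hβ1 (hw x) h0 hm
        hgle hgm) _).trans ?_
      rw [← ENNReal.ofReal_mul h0.le]
      refine ENNReal.ofReal_le_ofReal ?_
      -- For `f x > 1` the condition `1 + β ≤ γ` enters.
      have h2 : f x * f x ^ β ≤ f x ^ γ := by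
        rw [← Real.rpow_one_add' h0.le (by linarith)]
        exact Real.rpow_le_rpow_of_exponent_le h1.le hβγ
      calc f x * ((A * (1 + 1 / (1 / β - 1)) + m) * f x ^ β)
          = (A * (1 + 1 / (1 / β - 1)) + m) * (f x * f x ^ β) := by ring
        _ ≤ C * f x ^ γ := by
          refine mul_le_mul (by linarith) h2 (by positivity) hC0
  have hswap : ∫⁻ x, ∫⁻ y, G y x ∂μ ∂μ = ∫⁻ x, ∫⁻ y, G x y ∂μ ∂μ :=
    lintegral_lintegral_swap (f := fun x y => G y x) (hGm.comp measurable_swap).aemeasurable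
  calc ∫⁻ x, ∫⁻ y, F x y ∂μ ∂μ
      ≤ ∫⁻ x, ∫⁻ y, (G x y + G y x) ∂μ ∂μ :=
        lintegral_mono fun x => lintegral_mono fun y => hFG x y
    _ = ∫⁻ x, (∫⁻ y, G x y ∂μ + ∫⁻ y, G y x ∂μ) ∂μ :=
        lintegral_congr fun x => lintegral_add_left (hGm.comp measurable_prodMk_left) _
    _ = ∫⁻ x, ∫⁻ y, G x y ∂μ ∂μ + ∫⁻ x, ∫⁻ y, G y x ∂μ ∂μ :=
        lintegral_add_left hGm.lintegral_prod_right _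
    _ = ∫⁻ x, ∫⁻ y, G x y ∂μ ∂μ + ∫⁻ x, ∫⁻ y, G x y ∂μ ∂μ := by rw [hswap]
    _ = 2 * ∫⁻ x, ∫⁻ y, G x y ∂μ ∂μ := (two_mul _).symm
    _ ≤ 2 * ∫⁻ x, ENNReal.ofReal C * ENNReal.ofReal (growth γ |f x|) ∂μ := by
        gcongr with x
        exact hGle x
    _ = _ := by
        rw [lintegral_const_mul' _ _ ENNReal.ofReal_ne_top, ← mul_assoc,
          ENNReal.ofReal_mul zero_le_two, ENNReal.ofReal_ofNat]

end WeakType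

end EulerRiesz

/-! ### The interaction as a symmetric bilinear form -/

namespace EulerRiesz

/-- An even measurable kernel all of whose translates are, with respect to `μ`, of weak type
`1 / β` with constant `A`. -/
structure WeakTypeKernel {X : Type*} [AddCommGroup X] [MeasurableSpace X] (μ : Measure X)
    (β A : ℝ) (W : X → ℝ) : Prop where
  measurable : Measurable W
  even : ∀ x, W (-x) = W x
  measure_lt_le : ∀ x, ∀ s : ℝ, 0 < s →
    μ {y | s < |W (x - y)|} ≤ ENNReal.ofReal (A * s ^ (-(1 / β)))

section Interaction

variable {X : Type*} [AddCommGroup X] [MeasurableSpace X] {μ : Measure X} {W : X → ℝ}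
  {A β γ : ℝ}

theorem WeakTypeKernel.aestronglyMeasurable_mul [MeasurableSub₂ X] (hW : WeakTypeKernel μ β A W)
    {f g : X → ℝ} (hf : AEStronglyMeasurable f μ) (hg : AEStronglyMeasurable g μ) :
    AEStronglyMeasurable (fun z : X × X => W (z.1 - z.2) * (f z.1 * g z.2)) (μ.prod μ) :=
  (hW.measurable.comp measurable_sub).aestronglyMeasurable.mul (hf.comp_fst.mul hg.comp_snd)

/-- Lets a single majorant `F` settle the integrability of every mixed pairing. -/
theorem WeakTypeKernel.integrable_of_abs_le [MeasurableSub₂ X] (hW : WeakTypeKernel μ β A W)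
    {F f g : X → ℝ}
    (hF : Integrable (fun z : X × X => W (z.1 - z.2) * (F z.1 * F z.2)) (μ.prod μ))
    (hf : AEStronglyMeasurable f μ) (hg : AEStronglyMeasurable g μ)
    (hfF : ∀ᵐ x ∂μ, |f x| ≤ F x) (hgF : ∀ᵐ x ∂μ, |g x| ≤ F x) :
    Integrable (fun z : X × X => W (z.1 - z.2) * (f z.1 * g z.2)) (μ.prod μ) := by
  refine hF.mono (hW.aestronglyMeasurable_mul hf hg) ?_
  filter_upwards [Measure.quasiMeasurePreserving_fst.ae hfF,
    Measure.quasiMeasurePreserving_snd.ae hgF] with z h1 h2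
  rw [norm_mul, norm_mul, norm_mul, norm_mul]
  refine mul_le_mul_of_nonneg_left ?_ (norm_nonneg _)
  exact mul_le_mul (h1.trans (le_abs_self _)) (h2.trans (le_abs_self _)) (norm_nonneg _)
    (norm_nonneg _)

variable [SFinite μ]

theorem integrable_mul_potential {f g : X → ℝ}
    (h : Integrable (fun z : X × X => W (z.1 - z.2) * (f z.1 * g z.2)) (μ.prod μ)) :
    Integrable (fun x => f x * potential μ W g x) μ := by
  refine h.integral_prod_left.congr (ae_of_all _ fun x => ?_)
  simp only [potential]
  rw [← integral_const_mul]
  congr 1 with y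
  ring

theorem integral_mul_potential {f g : X → ℝ}
    (h : Integrable (fun z : X × X => W (z.1 - z.2) * (f z.1 * g z.2)) (μ.prod μ)) :
    ∫ x, f x * potential μ W g x ∂μ = ∫ z, W (z.1 - z.2) * (f z.1 * g z.2) ∂(μ.prod μ) := by
  rw [integral_prod _ h]
  congr 1 with x
  simp only [potential]
  rw [← integral_const_mul]
  congr 1 with y
  ring

/-- Fubini: exchanging the two variables only changes `W` into its reflection. -/
theorem integral_mul_potential_comm (hW : ∀ x, W (-x) = W x) {f g : X → ℝ}
    (h : Integrable (fun z : X × X => W (z.1 - z.2) * (f z.1 * g z.2)) (μ.prod μ)) :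
    ∫ x, f x * potential μ W g x ∂μ = ∫ x, g x * potential μ W f x ∂μ := by
  have he : ∀ z : X × X, W (z.swap.1 - z.swap.2) * (f z.swap.1 * g z.swap.2) =
      W (z.1 - z.2) * (g z.1 * f z.2) := by
    intro z
    rw [Prod.fst_swap, Prod.snd_swap, ← hW, neg_sub, mul_comm (f _)]
  have h' : Integrable (fun z : X × X => W (z.1 - z.2) * (g z.1 * f z.2)) (μ.prod μ) :=
    h.swap.congr (ae_of_all _ he)
  rw [integral_mul_potential h, integral_mul_potential h',
    ← integral_prod_swap (fun z : X × X => W (z.1 - z.2) * (f z.1 * g z.2))]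
  exact integral_congr_ae (ae_of_all _ he)

variable [MeasurableSub₂ X]

theorem WeakTypeKernel.lintegral_enorm_le [IsFiniteMeasure μ] (hW : WeakTypeKernel μ β A W)
    (hA : 0 ≤ A) (hβ : 0 < β) (hβ1 : β < 1) (hβγ : 1 + β ≤ γ) {f : X → ℝ} (hf : AEStronglyMeasurable f μ)
    {m : ℝ} (hm : 0 ≤ m) (hfm : ∫⁻ y, ENNReal.ofReal |f y| ∂μ ≤ ENNReal.ofReal m) :
    ∫⁻ z, ‖W (z.1 - z.2) * (f z.1 * f z.2)‖ₑ ∂(μ.prod μ) ≤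
      ENNReal.ofReal (2 * (A * (1 + 1 / (1 / β - 1)) + m + μ.real Set.univ)) *
        ∫⁻ x, ENNReal.ofReal (growth γ |f x|) ∂μ := by
  rw [lintegral_prod _ (hW.aestronglyMeasurable_mul hf hf).enorm]
  have h := lintegral_interaction_le (μ := μ) (K := fun x y => |W (x - y)|)
    (hW.measurable.comp measurable_sub).abs (fun _ _ => abs_nonneg _)
    (fun x y => by rw [← hW.even, neg_sub]) hA hβ hβ1 hβγ hW.measure_lt_le
    hf.aemeasurable.abs hm hfm
  simp only [abs_abs] at h
  refine le_trans (le_of_eq ?_) h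
  simp only [enorm_mul, Real.enorm_eq_ofReal_abs]

theorem WeakTypeKernel.integrable_self [IsFiniteMeasure μ] (hW : WeakTypeKernel μ β A W)
    (hA : 0 ≤ A) (hβ : 0 < β) (hβ1 : β < 1) (hβγ : 1 + β ≤ γ) {f : X → ℝ} (hf : Integrable f μ)
    (hfγ : Integrable (fun x => |f x| ^ γ) μ) :
    Integrable (fun z : X × X => W (z.1 - z.2) * (f z.1 * f z.2)) (μ.prod μ) := by
  refine ⟨hW.aestronglyMeasurable_mul hf.1 hf.1, ?_⟩
  have hm : ∫⁻ y, ENNReal.ofReal |f y| ∂μ ≤ ENNReal.ofReal (∫ y, |f y| ∂μ) := by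
    rw [ofReal_integral_eq_lintegral_ofReal hf.abs (ae_of_all _ fun _ => abs_nonneg _)]
  refine (hW.lintegral_enorm_le hA hβ hβ1 hβγ hf.1 (integral_nonneg fun _ => abs_nonneg _)
    hm).trans_lt ?_
  refine ENNReal.mul_lt_top ENNReal.ofReal_lt_top ?_
  refine (lintegral_mono fun x => ENNReal.ofReal_le_ofReal
    (growth_le (γ := γ) (abs_nonneg (f x)))).trans_lt ?_
  exact ((integrable_const (1 : ℝ)).add hfγ).lintegral_lt_top

end Interaction

/-! ### Energy identity and absorption of the interaction -/

section RelativeEnergy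

variable {X : Type*} [AddCommGroup X] [MeasurableSpace X] {μ : Measure X}
  {W : X → ℝ} {γ : ℝ} {ρ ρ' : X → ℝ}

theorem relPotentialEnergy_eq {κ : ℝ} (hFE : FiniteEnergies μ W γ κ ρ ρ')
    (hpot : ∀ᵐ x ∂μ, Integrable (fun y => W (x - y) * ρ y) μ)
    (hpot' : ∀ᵐ x ∂μ, Integrable (fun y => W (x - y) * ρ' y) μ)
    (h12 : Integrable (fun x => ρ x * potential μ W ρ' x) μ)
    (h21 : Integrable (fun x => ρ' x * potential μ W ρ x) μ)
    (hsymm : ∫ x, ρ x * potential μ W ρ' x ∂μ = ∫ x, ρ' x * potential μ W ρ x ∂μ) :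
    relPotentialEnergy μ W γ κ ρ ρ' =
      ∫ x, (relInternalEnergy γ (ρ x) (ρ' x) + κ * (1 / 2) * relInteraction μ W ρ ρ' x) ∂μ := by
  -- The two integrands differ pointwise by this antisymmetric cross term, so they agree only after
  -- integration.
  have hz : ∫ x, κ * (1 / 2) * (ρ x * potential μ W ρ' x - ρ' x * potential μ W ρ x) ∂μ = 0 := by
    rw [integral_const_mul, integral_sub h12 h21, hsymm, sub_self, mul_zero]
  unfold relPotentialEnergy potentialEnergy
  have hI := (hFE.left.sub hFE.right).sub hFE.pairing
  have hJ : Integrable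
      (fun x => κ * (1 / 2) * (ρ x * potential μ W ρ' x - ρ' x * potential μ W ρ x)) μ :=
    (h12.sub h21).const_mul _
  rw [← integral_sub' hFE.left hFE.right, ← integral_sub' (hFE.left.sub hFE.right) hFE.pairing,
    ← add_zero (∫ x, _ ∂μ), ← hz, ← integral_add hI hJ]
  refine integral_congr_ae ?_
  filter_upwards [hpot, hpot'] with x h1 h2
  have hsub : potential μ W (fun y => ρ y - ρ' y) x = potential μ W ρ x - potential μ W ρ' x := by
    simp only [potential]
    rw [← integral_sub h1 h2]
    congr 1 with y
    ring
  simp only [Pi.sub_apply, energyDensity, energyVariation, relInteraction, relInternalEnergy, hsub]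
  ring

theorem internal_le_relPotentialEnergy {κ C : ℝ} (hκ : 0 < κ) (hC : 0 < C) (hκC : κ < 2 / C)
    (hE : RelEnergyEstimate μ W γ C ρ ρ')
    (heq : relPotentialEnergy μ W γ κ ρ ρ' =
      ∫ x, (relInternalEnergy γ (ρ x) (ρ' x) + κ * (1 / 2) * relInteraction μ W ρ ρ' x) ∂μ)
    (h0 : 0 ≤ ∫ x, relInternalEnergy γ (ρ x) (ρ' x) ∂μ) :
    ∫ x, relInternalEnergy γ (ρ x) (ρ' x) ∂μ ≤
        1 / (1 - κ * C / 2) * relPotentialEnergy μ W γ κ ρ ρ' ∧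
      0 ≤ relPotentialEnergy μ W γ κ ρ ρ' := by
  have hl : 0 < 1 - κ * C / 2 := by
    rw [lt_div_iff₀ hC] at hκC
    linarith
  have hmain : (1 - κ * C / 2) * ∫ x, relInternalEnergy γ (ρ x) (ρ' x) ∂μ ≤
      relPotentialEnergy μ W γ κ ρ ρ' := by
    rw [heq, integral_add hE.integrable_internal (hE.integrable_interaction.const_mul _),
      integral_const_mul]
    have h1 := mul_le_mul_of_nonneg_left
      ((neg_le_abs _).trans hE.interaction_le) (by positivity : 0 ≤ κ * (1 / 2))
    linarith
  refine ⟨?_, (mul_nonneg hl.le h0).trans hmain⟩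
  rw [one_div, ← div_eq_inv_mul, le_div_iff₀ hl]
  linarith

end RelativeEnergy

end EulerRiesz

namespace EulerRiesz

/-! ### Assembly on a finite measure space -/

section Abstract

variable {X : Type*} [MeasurableSpace X] {μ : Measure X}

theorem integrable_rpow_of_memLp {f : X → ℝ} {γ : ℝ} (hγ : 0 < γ)
    (hf : MemLp f (ENNReal.ofReal γ) μ) : Integrable (fun x => |f x| ^ γ) μ := by
  have h := hf.integrable_norm_rpow (by simpa using hγ) ENNReal.ofReal_ne_top
  rwa [ENNReal.toReal_ofReal hγ.le] at h

theorem integrable_internalEnergy {f : X → ℝ} {γ : ℝ} (hγ : 0 < γ)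
    (hf : MemLp f (ENNReal.ofReal γ) μ) (hf0 : ∀ᵐ x ∂μ, 0 ≤ f x) :
    Integrable (fun x => internalEnergy γ (f x)) μ := by
  refine ((integrable_rpow_of_memLp hγ hf).const_mul (1 / (γ - 1))).congr ?_
  filter_upwards [hf0] with x hx
  rw [abs_of_nonneg hx, internalEnergy]

variable {γ δ Mbar M : ℝ} {ρ ρ' : X → ℝ}

theorem Admissible.abs_right_le (h : Admissible μ γ δ Mbar M ρ ρ') (hδ : 0 < δ) :
    ∀ᵐ x ∂μ, |ρ' x| ≤ |Mbar| := by
  filter_upwards [h.lower, h.upper] with x h1 h2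
  rw [abs_of_pos (hδ.trans_le h1)]
  exact h2.trans (le_abs_self _)

variable [IsFiniteMeasure μ]

theorem Admissible.integrable_left (h : Admissible μ γ δ Mbar M ρ ρ') (hγ : 1 < γ) :
    Integrable ρ μ :=
  h.memLp.integrable (by simpa using hγ.le)

theorem Admissible.integrable_right (h : Admissible μ γ δ Mbar M ρ ρ') : Integrable ρ' μ :=
  h.memLp_top.integrable le_top

theorem Admissible.integrable_deriv_mul (h : Admissible μ γ δ Mbar M ρ ρ') (hγ : 1 < γ)
    (hδ : 0 < δ) :
    Integrable (fun x => deriv (internalEnergy γ) (ρ' x) * (ρ x - ρ' x)) μ := by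
  have hd : deriv (internalEnergy γ) = fun r => γ / (γ - 1) * r ^ (γ - 1) :=
    funext fun r => (hasDerivAt_internalEnergy hγ r).deriv
  rw [hd]
  refine ((h.integrable_left hγ).sub h.integrable_right).bdd_mul
    (c := γ / (γ - 1) * |Mbar| ^ (γ - 1)) ?_ ?_
  · exact ((h.integrable_right.aestronglyMeasurable.aemeasurable.pow_const _).const_mul
      _).aestronglyMeasurable
  · have hγ' : 0 ≤ γ / (γ - 1) := div_nonneg (by linarith) (by linarith)
    filter_upwards [h.abs_right_le hδ] with x hx
    rw [norm_mul, Real.norm_of_nonneg hγ']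
    refine mul_le_mul_of_nonneg_left ?_ hγ'
    exact (Real.abs_rpow_le_abs_rpow _ _).trans
      (Real.rpow_le_rpow (abs_nonneg _) hx (by linarith))

/-- Supplies the mass `m` of the interaction inequality, uniformly over admissible pairs. -/
theorem Admissible.lintegral_abs_sub_le (h : Admissible μ γ δ Mbar M ρ ρ') (hγ : 1 < γ)
    (hδ : 0 < δ) :
    ∫⁻ x, ENNReal.ofReal |ρ x - ρ' x| ∂μ ≤
      ENNReal.ofReal (|M| + |Mbar| * μ.real Set.univ) := by
  have hi : Integrable (fun x => ρ x - ρ' x) μ := (h.integrable_left hγ).sub h.integrable_right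
  rw [← ofReal_integral_eq_lintegral_ofReal hi.abs (ae_of_all _ fun _ => abs_nonneg _)]
  refine ENNReal.ofReal_le_ofReal ?_
  calc ∫ x, |ρ x - ρ' x| ∂μ ≤ ∫ x, (ρ x + |Mbar|) ∂μ := by
        refine integral_mono_ae hi.abs ((h.integrable_left hγ).add (integrable_const _)) ?_
        filter_upwards [h.nonneg, h.abs_right_le hδ] with x h1 h2
        refine (abs_sub _ _).trans ?_
        rw [abs_of_nonneg h1]
        linarith
    _ = ∫ x, ρ x ∂μ + |Mbar| * μ.real Set.univ := by
        rw [integral_add (h.integrable_left hγ) (integrable_const _), integral_const,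
          smul_eq_mul, mul_comm]
    _ ≤ |M| + |Mbar| * μ.real Set.univ := by
        have := h.mass_le.trans (le_abs_self M)
        linarith

end Abstract

variable {X : Type*} [AddCommGroup X] [MeasurableSpace X]

/-- The relative energy estimate, the identity for the relative potential energy, and the
resulting stability estimate, for all kernels of a given weak type on a finite measure space. -/
theorem exists_relEnergyEstimate [MeasurableSub₂ X] (μ : Measure X) [IsFiniteMeasure μ]
    {A β γ δ : ℝ} (hA : 0 ≤ A) (hβ : 0 < β) (hβ1 : β < 1) (hβγ : 1 + β ≤ γ) (hδ : 0 < δ)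
    (Mbar M : ℝ) :
    ∃ C : ℝ, 0 < C ∧ ∀ W : X → ℝ, WeakTypeKernel μ β A W → ∀ ρ ρ' : X → ℝ,
      Admissible μ γ δ Mbar M ρ ρ' → RelEnergyEstimate μ W γ C ρ ρ' ∧
      ∀ κ : ℝ, 0 < κ → FiniteEnergies μ W γ κ ρ ρ' ∧
        relPotentialEnergy μ W γ κ ρ ρ' =
          ∫ x, (relInternalEnergy γ (ρ x) (ρ' x) + κ * (1 / 2) * relInteraction μ W ρ ρ' x) ∂μ ∧
        (κ < 2 / C →
          0 ≤ ∫ x, relInternalEnergy γ (ρ x) (ρ' x) ∂μ ∧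
          ∫ x, relInternalEnergy γ (ρ x) (ρ' x) ∂μ ≤
            1 / (1 - κ * C / 2) * relPotentialEnergy μ W γ κ ρ ρ' ∧
          0 ≤ relPotentialEnergy μ W γ κ ρ ρ') := by
  have hγ : 1 < γ := by linarith
  have hp : 1 < 1 / β := one_lt_one_div hβ hβ1
  have hp1 : 0 < 1 / β - 1 := by linarith
  obtain ⟨c, hc, hgrowth⟩ := exists_growth_le_relInternalEnergy (b := Mbar) hγ hδ
  have hμ0 : 0 ≤ μ.real Set.univ := measureReal_nonneg
  set m : ℝ := |M| + |Mbar| * μ.real Set.univ with hm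
  have hm0 : 0 ≤ m := by positivity
  set C₁ : ℝ := 2 * (A * (1 + 1 / (1 / β - 1)) + m + μ.real Set.univ) with hC₁
  have hC₁0 : 0 ≤ C₁ := by positivity
  -- The added `1` keeps the constant positive even if `C₁ = 0`.
  have hC : 0 < (C₁ + 1) / c := by positivity
  refine ⟨(C₁ + 1) / c, hC, fun W hW ρ ρ' h => ?_⟩
  have hρ := h.integrable_left hγ
  have hρ' := h.integrable_right
  have hρ'γ : MemLp ρ' (ENNReal.ofReal γ) μ := h.memLp_top.mono_exponent le_top
  have hρ'0 : ∀ᵐ x ∂μ, 0 ≤ ρ' x := h.lower.mono fun x hx => hδ.le.trans hx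
  -- `F` dominates `ρ`, `ρ'`, their difference and the constant `1`; pairing `1` with `ρ` or `ρ'`
  -- gives the almost everywhere convergence of the potentials.
  set F : X → ℝ := fun x => |ρ x| + (|Mbar| + 1) with hF
  have hFγ : MemLp F (ENNReal.ofReal γ) μ := h.memLp.abs.add (memLp_const _)
  have hFF : Integrable (fun z : X × X => W (z.1 - z.2) * (F z.1 * F z.2)) (μ.prod μ) :=
    hW.integrable_self hA hβ hβ1 hβγ (hρ.abs.add (integrable_const _))
      (integrable_rpow_of_memLp (by linarith) hFγ)
  have hρF : ∀ᵐ x ∂μ, |ρ x| ≤ F x := ae_of_all _ fun x => by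
    simp only [hF]
    linarith [abs_nonneg Mbar]
  have hρ'F : ∀ᵐ x ∂μ, |ρ' x| ≤ F x := by
    filter_upwards [h.abs_right_le hδ] with x hx
    simp only [hF]
    linarith [abs_nonneg (ρ x)]
  have hdF : ∀ᵐ x ∂μ, |ρ x - ρ' x| ≤ F x := by
    filter_upwards [h.abs_right_le hδ] with x hx
    simp only [hF]
    linarith [abs_sub (ρ x) (ρ' x)]
  have h1F : ∀ᵐ x ∂μ, |(1 : ℝ)| ≤ F x := ae_of_all _ fun x => by
    simp only [hF, abs_one]
    linarith [abs_nonneg Mbar, abs_nonneg (ρ x)]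
  have hd := hρ.sub hρ'
  have h1ρ := hW.integrable_of_abs_le hFF (aestronglyMeasurable_const (b := (1 : ℝ))) hρ.1 h1F hρF
  have h1ρ' :=
    hW.integrable_of_abs_le hFF (aestronglyMeasurable_const (b := (1 : ℝ))) hρ'.1 h1F hρ'F
  have h11 := hW.integrable_of_abs_le hFF hρ.1 hρ.1 hρF hρF
  have h12 := hW.integrable_of_abs_le hFF hρ.1 hρ'.1 hρF hρ'F
  have h21 := hW.integrable_of_abs_le hFF hρ'.1 hρ.1 hρ'F hρF
  have h22 := hW.integrable_of_abs_le hFF hρ'.1 hρ'.1 hρ'F hρ'F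
  have hd2 := hW.integrable_of_abs_le hFF hd.1 hρ'.1 hdF hρ'F
  have hdd := hW.integrable_of_abs_le hFF hd.1 hd.1 hdF hdF
  have hpot : ∀ᵐ x ∂μ, Integrable (fun y => W (x - y) * ρ y) μ := by
    simpa only [one_mul] using h1ρ.prod_right_ae
  have hpot' : ∀ᵐ x ∂μ, Integrable (fun y => W (x - y) * ρ' y) μ := by
    simpa only [one_mul] using h1ρ'.prod_right_ae
  have hint : Integrable (fun x => internalEnergy γ (ρ x)) μ :=
    integrable_internalEnergy (by linarith) h.memLp h.nonneg
  have hint' : Integrable (fun x => internalEnergy γ (ρ' x)) μ :=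
    integrable_internalEnergy (by linarith) hρ'γ hρ'0
  have hder := h.integrable_deriv_mul hγ hδ
  have hrel : Integrable (fun x => relInternalEnergy γ (ρ x) (ρ' x)) μ :=
    (hint.sub hint').sub hder
  have hgae : ∀ᵐ x ∂μ, c * growth γ |ρ x - ρ' x| ≤ relInternalEnergy γ (ρ x) (ρ' x) := by
    filter_upwards [h.nonneg, h.lower, h.upper] with x h1 h2 h3
    exact hgrowth _ _ h1 h2 h3
  have hrel0 : ∀ᵐ x ∂μ, 0 ≤ relInternalEnergy γ (ρ x) (ρ' x) := by
    filter_upwards [hgae] with x hx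
    exact (mul_nonneg hc.le (growth_nonneg γ (abs_nonneg _))).trans hx
  have hI0 : 0 ≤ ∫ x, relInternalEnergy γ (ρ x) (ρ' x) ∂μ := integral_nonneg_of_ae hrel0
  have hgl : ∫⁻ x, ENNReal.ofReal (growth γ |ρ x - ρ' x|) ∂μ ≤
      ENNReal.ofReal ((∫ x, relInternalEnergy γ (ρ x) (ρ' x) ∂μ) / c) := by
    rw [← integral_div, ofReal_integral_eq_lintegral_ofReal (hrel.div_const c)
      (hrel0.mono fun x hx => div_nonneg hx hc.le)]
    refine lintegral_mono_ae ?_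
    filter_upwards [hgae] with x hx
    refine ENNReal.ofReal_le_ofReal ?_
    rw [le_div_iff₀ hc]
    linarith
  have hE : RelEnergyEstimate μ W γ ((C₁ + 1) / c) ρ ρ' := by
    refine ⟨hpot, hpot', integrable_mul_potential hdd, hrel, ?_⟩
    have h1 : ∫ x, relInteraction μ W ρ ρ' x ∂μ =
        ∫ z, W (z.1 - z.2) * ((ρ z.1 - ρ' z.1) * (ρ z.2 - ρ' z.2)) ∂(μ.prod μ) :=
      integral_mul_potential hdd
    have h2 := hW.lintegral_enorm_le (γ := γ) hA hβ hβ1 hβγ hd.1 hm0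
      (h.lintegral_abs_sub_le hγ hδ)
    have h3 := h2.trans (mul_le_mul_right hgl _)
    rw [← ENNReal.ofReal_mul hC₁0] at h3
    rw [h1, ← Real.norm_eq_abs]
    refine (norm_integral_le_lintegral_norm _).trans ?_
    refine ENNReal.toReal_le_of_le_ofReal (by positivity) ?_
    simp only [ofReal_norm]
    refine h3.trans (ENNReal.ofReal_le_ofReal ?_)
    rw [← mul_div_assoc, div_mul_eq_mul_div]
    gcongr
    linarith
  refine ⟨hE, fun κ hκ => ?_⟩
  have hFE : FiniteEnergies μ W γ κ ρ ρ' := by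
    refine ⟨hint.add ((integrable_mul_potential h11).const_mul _),
      hint'.add ((integrable_mul_potential h22).const_mul _), ?_⟩
    refine (hder.add ((integrable_mul_potential hd2).const_mul κ)).congr
      (ae_of_all _ fun x => ?_)
    simp only [Pi.add_apply, Pi.sub_apply, energyVariation]
    ring
  have heq := relPotentialEnergy_eq hFE hpot hpot' (integrable_mul_potential h12)
    (integrable_mul_potential h21) (integral_mul_potential_comm hW.even h12)
  exact ⟨hFE, heq, fun hκC => ⟨hI0, internal_le_relPotentialEnergy hκ hC hκC hE heq hI0⟩⟩

end EulerRiesz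

/-! ### Riesz kernels on domains and tori are of weak type -/

namespace EulerRiesz

theorem abs_rieszProfile {s α r : ℝ} (hs : s = 1 ∨ s = -1) (hα : α < 0) (hr : 0 ≤ r) :
    |rieszProfile s α r| = r ^ α / -α := by
  have hs1 : |s| = 1 := by rcases hs with rfl | rfl <;> simp
  rw [rieszProfile, abs_mul, hs1, one_mul, abs_div, abs_of_neg hα,
    abs_of_nonneg (Real.rpow_nonneg hr _)]

/-- If balls of radius `r` have measure `O(r ^ d)`, then the Riesz kernel of exponent `α` is of weak
type `d / -α`. -/
theorem weakTypeKernel_rieszProfile {X : Type*} [AddCommGroup X] [MeasurableSpace X]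
    {μ : Measure X} {ℓ : X → ℝ} (hℓ : Measurable ℓ) (hℓ0 : ∀ x, 0 ≤ ℓ x)
    (hℓs : ∀ x, ℓ (-x) = ℓ x) {d : ℕ} {V : ℝ}
    (hball : ∀ x, ∀ r : ℝ, 0 < r → μ {y | ℓ (x - y) < r} ≤ ENNReal.ofReal (V * r ^ d))
    {s α : ℝ} (hs : s = 1 ∨ s = -1) (hα : α < 0) :
    WeakTypeKernel μ (-α / d) (V * (-α) ^ (d / α)) (fun x => rieszProfile s α (ℓ x)) where
  measurable := ((hℓ.pow_const α).div_const α).const_mul s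
  even x := by rw [hℓs]
  measure_lt_le x t ht := by
    have hα0 : 0 < -α := by linarith
    have hτ : 0 < t * -α := mul_pos ht hα0
    -- As `α < 0`, `|W| > t` forces the length below this radius.
    have hr : 0 < (t * -α) ^ (1 / α) := Real.rpow_pos_of_pos hτ _
    refine (measure_mono fun y hy => ?_).trans ((hball x _ hr).trans
      (ENNReal.ofReal_le_ofReal (le_of_eq ?_)))
    · simp only [Set.mem_ofPred_eq, abs_rieszProfile hs hα (hℓ0 _), lt_div_iff₀ hα0] at hy ⊢
      -- By the convention `0 ^ α = 0`, the kernel vanishes at the origin, so the superlevel set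
      -- misses it.
      have hpos : 0 < ℓ (x - y) := by
        refine (hℓ0 _).lt_of_ne fun h => ?_
        rw [← h, Real.zero_rpow hα.ne] at hy
        linarith
      have h := Real.rpow_lt_rpow_of_neg hτ hy (one_div_neg.2 hα)
      rwa [← Real.rpow_mul hpos.le, mul_one_div_cancel hα.ne, Real.rpow_one] at h
    · rw [← Real.rpow_natCast, ← Real.rpow_mul hτ.le, Real.mul_rpow ht.le hα0.le, one_div_div,
        div_neg, neg_neg, one_div_mul_eq_div]
      ring

theorem weakTypeKernel_euclideanKernel (d : ℕ) {s α : ℝ} (hs : s = 1 ∨ s = -1) (hα : α < 0)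
    (Ω : Set (EuclideanSpace ℝ (Fin d))) :
    WeakTypeKernel (volume.restrict Ω) (-α / d)
      ((volume (Metric.ball (0 : EuclideanSpace ℝ (Fin d)) 1)).toReal * (-α) ^ (d / α))
      (euclideanKernel d s α) := by
  refine weakTypeKernel_rieszProfile (ℓ := fun x => ‖x‖) measurable_norm
    (fun x => norm_nonneg x) (fun x => norm_neg x) (fun x r hr => ?_) hs hα
  have hset : {y | ‖x - y‖ < r} = Metric.ball x r := by
    ext y
    rw [Metric.mem_ball', dist_eq_norm, Set.mem_ofPred_eq]
  rw [hset]
  refine (Measure.restrict_apply_le _ _).trans ?_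
  rw [Measure.addHaar_ball_of_pos _ _ hr, finrank_euclideanSpace_fin, mul_comm,
    ENNReal.ofReal_mul ENNReal.toReal_nonneg, ENNReal.ofReal_toReal measure_ball_lt_top.ne]

theorem norm_le_torusLength {d : ℕ} {L : ℝ} (x : Torus d L) (i : Fin d) :
    ‖x i‖ ≤ torusLength x :=
  Real.le_sqrt_of_sq_le
    (Finset.single_le_sum (f := fun i => ‖x i‖ ^ 2) (fun _ _ => sq_nonneg _) (Finset.mem_univ i))

theorem measurable_torusLength {d : ℕ} {L : ℝ} : Measurable (torusLength (d := d) (L := L)) := by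
  refine (Finset.measurable_sum _ fun i _ => ?_).sqrt
  exact ((measurable_pi_apply i).norm).pow_const 2

theorem weakTypeKernel_torusKernel (d : ℕ) (L : ℝ) [Fact (0 < L)] {s α : ℝ}
    (hs : s = 1 ∨ s = -1) (hα : α < 0) :
    WeakTypeKernel volume (-α / d) (2 ^ d * (-α) ^ (d / α)) (torusKernel d L s α) := by
  refine weakTypeKernel_rieszProfile measurable_torusLength (fun x => Real.sqrt_nonneg _)
    (fun x => ?_) (fun x r hr => ?_) hs hα
  · simp [torusLength]
  · calc volume {y : Torus d L | torusLength (x - y) < r}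
        -- A ball lies in the cube of half-side `r`, which is a product of arcs.
        ≤ volume (Set.pi Set.univ fun i => Metric.closedBall (x i) r) := by
          refine measure_mono fun y hy i _ => ?_
          rw [Metric.mem_closedBall', dist_eq_norm]
          exact (norm_le_torusLength (x - y) i).trans (le_of_lt hy)
      _ = ∏ _i : Fin d, ENNReal.ofReal (min L (2 * r)) := by
          rw [volume_pi_pi]
          simp only [AddCircle.volume_closedBall]
      _ ≤ ENNReal.ofReal (2 * r) ^ d := by
          rw [Finset.prod_const, Finset.card_univ, Fintype.card_fin]
          gcongr
          exact min_le_right _ _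
      _ = ENNReal.ofReal (2 ^ d * r ^ d) := by
          rw [← ENNReal.ofReal_pow (by positivity), mul_pow]

end EulerRiesz

theorem mainTheorem3 (d : ℕ) (hd : 1 ≤ d) (α γ : ℝ) (hα : -(d : ℝ) < α) (hα' : α < 0)
    (hγ : 2 - (α + d) / d ≤ γ) (δ Mbar M : ℝ) (hδ : 0 < δ) :
    -- a bounded domain of `ℝ^d`
    (∀ Ω : Set (EuclideanSpace ℝ (Fin d)), IsOpen Ω → IsConnected Ω → Bornology.IsBounded Ω →
      ∃ C : ℝ, 0 < C ∧ ∀ (s : ℝ) (ρ ρbar : EuclideanSpace ℝ (Fin d) → ℝ), s = 1 ∨ s = -1 →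
        EulerRiesz.Admissible (volume.restrict Ω) γ δ Mbar M ρ ρbar →
        EulerRiesz.RelEnergyEstimate (volume.restrict Ω) (EulerRiesz.euclideanKernel d s α)
          γ C ρ ρbar ∧
        ∀ κ : ℝ, 0 < κ →
          EulerRiesz.FiniteEnergies (volume.restrict Ω) (EulerRiesz.euclideanKernel d s α)
            γ κ ρ ρbar ∧
          EulerRiesz.relPotentialEnergy (volume.restrict Ω) (EulerRiesz.euclideanKernel d s α)
              γ κ ρ ρbar =
            ∫ x in Ω, (EulerRiesz.relInternalEnergy γ (ρ x) (ρbar x) + κ * (1 / 2) *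
              EulerRiesz.relInteraction (volume.restrict Ω) (EulerRiesz.euclideanKernel d s α)
                ρ ρbar x) ∧
          (κ < 2 / C →
            0 ≤ ∫ x in Ω, EulerRiesz.relInternalEnergy γ (ρ x) (ρbar x) ∧
            ∫ x in Ω, EulerRiesz.relInternalEnergy γ (ρ x) (ρbar x) ≤
              1 / (1 - κ * C / 2) *
                EulerRiesz.relPotentialEnergy (volume.restrict Ω)
                  (EulerRiesz.euclideanKernel d s α) γ κ ρ ρbar ∧
            0 ≤ EulerRiesz.relPotentialEnergy (volume.restrict Ω)
                  (EulerRiesz.euclideanKernel d s α) γ κ ρ ρbar)) ∧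
    -- the flat torus `(ℝ / Lℤ)^d`
    (∀ (L : ℝ) [Fact (0 < L)],
      ∃ C : ℝ, 0 < C ∧ ∀ (s : ℝ) (ρ ρbar : EulerRiesz.Torus d L → ℝ), s = 1 ∨ s = -1 →
        EulerRiesz.Admissible volume γ δ Mbar M ρ ρbar →
        EulerRiesz.RelEnergyEstimate volume (EulerRiesz.torusKernel d L s α) γ C ρ ρbar ∧
        ∀ κ : ℝ, 0 < κ →
          EulerRiesz.FiniteEnergies volume (EulerRiesz.torusKernel d L s α) γ κ ρ ρbar ∧
          EulerRiesz.relPotentialEnergy volume (EulerRiesz.torusKernel d L s α) γ κ ρ ρbar =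
            ∫ x, (EulerRiesz.relInternalEnergy γ (ρ x) (ρbar x) + κ * (1 / 2) *
              EulerRiesz.relInteraction volume (EulerRiesz.torusKernel d L s α) ρ ρbar x) ∧
          (κ < 2 / C →
            0 ≤ ∫ x, EulerRiesz.relInternalEnergy γ (ρ x) (ρbar x) ∧
            ∫ x, EulerRiesz.relInternalEnergy γ (ρ x) (ρbar x) ≤
              1 / (1 - κ * C / 2) *
                EulerRiesz.relPotentialEnergy volume (EulerRiesz.torusKernel d L s α)
                  γ κ ρ ρbar ∧
            0 ≤ EulerRiesz.relPotentialEnergy volume (EulerRiesz.torusKernel d L s α)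
                  γ κ ρ ρbar)) := by
  have hd0 : (0 : ℝ) < d := by exact_mod_cast hd
  have hβ : 0 < -α / d := div_pos (by linarith) hd0
  have hβ1 : -α / d < 1 := by
    rw [div_lt_one hd0]
    linarith
  -- `2 - (α + d) / d = 1 + β` for `β = -α / d`.
  have hβγ : 1 + -α / d ≤ γ := by
    refine le_trans (le_of_eq ?_) hγ
    field_simp
    ring
  have hpow : 0 ≤ (-α) ^ (d / α) := Real.rpow_nonneg (by linarith) _
  constructor
  · intro Ω _ _ hΩ
    have : IsFiniteMeasure (volume.restrict Ω) := ⟨by simpa using hΩ.measure_lt_top⟩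
    -- The weak-type constant does not involve `s`, so one `C` serves both signs.
    obtain ⟨C, hC, h⟩ := EulerRiesz.exists_relEnergyEstimate (volume.restrict Ω)
      (mul_nonneg ENNReal.toReal_nonneg hpow) hβ hβ1 hβγ hδ Mbar M
    exact ⟨C, hC, fun s ρ ρbar hs hadm =>
      h _ (EulerRiesz.weakTypeKernel_euclideanKernel d hs hα' Ω) ρ ρbar hadm⟩
  · intro L _
    obtain ⟨C, hC, h⟩ := EulerRiesz.exists_relEnergyEstimate
      (volume : Measure (EulerRiesz.Torus d L))
      (mul_nonneg (by positivity : (0 : ℝ) ≤ 2 ^ d) hpow) hβ hβ1 hβγ hδ Mbar M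
    exact ⟨C, hC, fun s ρ ρbar hs hadm =>
      h _ (EulerRiesz.weakTypeKernel_torusKernel d L hs hα') ρ ρbar hadm⟩
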